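/- **Setting.** A planar straight line graph (PSLG) $G$ consists of finitely many vertices in $\mathbb{R}^2$ and finitely many nondegenerate straight segments between vertices, such that a segment contains no vertices other than its endpoints and two distinct segments meet at most in common endpoints. Its features are its vertices and its closed segments; two features are nonadjacent if they are disjoint. The local feature size $\mathrm{LFS}(x)$ of $x\in\mathbb{R}^2$ is the radius of the smallest closed disk centred at $x$ that meets two nonadjacent features. A splitting of $G$ is a finite point set $S_0$ that contains the vertices of $G$ and otherwise consists of points of its segments; a subsegment $pq$ joins two consecutive points $p,q$ of $S_0$ on a segment of $G$. Let $A^*>0$ and $B^*$ be constants such that $$A^*\le\frac{\mathrm{LFS}(p)}{|pq|}\le B^*$$ for every subsegment $pq$ and each of its endpoints $p$. Assume that $G$ has no small angle, i.e. any two distinct segments with a common endpoint form an angle greater than $\arccos\frac{1}{2R}$, where $R=B^*/A^*$ (this holds in particular if all these angles are at least $\pi/2$). Let $0<\theta^*<\pi/6$ be the desired minimum angle and $\alpha=1/(2\sin\theta^*)$ the desired maximum radius-edge ratio. A triangle is skinny if its minimum angle is less than $\theta^*$. Let $\Omega\subseteq\mathbb{R}^2$ be the region to be meshed (for example $\mathbb{R}^2$,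 or a region bounded by segments of $G$; no condition on $\Omega$ is needed). The refinement starts from the vertex set $S_0$ and repeats the following step as long as possible. Take a Delaunay triangulation of the current vertex set, and among its skinny triangles contained in $\Omega$ choose one, $t$, whose shortest edge is as short as possible. Let $e$ be a shortest edge of $t$. The off-center of $t$ is the point of the perpendicular bisector of $e$, on the same side of $e$ as $t$, at which $e$ subtends the angle $\theta^*$. Insert as a new vertex (the Steiner vertex $a$ of $t$) the off-center or the circumcenter of $t$, whichever is closer to $e$. The Steiner vertex $a$ encroaches upon a subsegment $pq$ if $pq$ separates $a$ from $t$, in the sense that the line segment from some interior point of $t$ to $a$ meets $pq$. **Lemma.** If $$\frac{B^*}{A^*}+\frac{\alpha}{A^*(\alpha-1)}+\frac{2}{A^*}\le\sqrt2,$$ then, at every step of the refinement, the Steiner vertex does not lie in the closed disk bounded by the diametral circle of any subsegment of $G$ (the circle having that subsegment as a diameter), and it does not encroach upon any subsegment. -/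

import Mathlib

/-- The Euclidean plane. -/
abbrev Plane : Type := EuclideanSpace ℝ (Fin 2)

/-- A planar straight line graph: finitely many vertices, finitely many nondegenerate straight
segments (given by their endpoints) between vertices, such that a segment contains no vertices
besides its endpoints and two different segments meet at most in common endpoints. -/
structure PSLG where
  vertices : Finset Plane
  segments : Finset (Plane × Plane)
  endpoints_mem : ∀ e ∈ segments, e.1 ∈ vertices ∧ e.2 ∈ vertices
  endpoints_ne : ∀ e ∈ segments, e.1 ≠ e.2
  vertex_on_segment : ∀ e ∈ segments, ∀ v ∈ vertices, v ∈ segment ℝ e.1 e.2 → v = e.1 ∨ v = e.2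
  segments_inter : ∀ e ∈ segments, ∀ e' ∈ segments, e ≠ e' →
    segment ℝ e.1 e.2 ∩ segment ℝ e'.1 e'.2 ⊆ ({e.1, e.2} : Set Plane) ∩ {e'.1, e'.2}

namespace PSLG

/-- `x` and `y` are the two endpoints of a segment. -/
def Joins (G : PSLG) (x y : Plane) : Prop :=
  (x, y) ∈ G.segments ∨ (y, x) ∈ G.segments

/-- The features of a PSLG are its vertices and its (closed) segments. -/
def features (G : PSLG) : Set (Set Plane) :=
  {f | (∃ v ∈ G.vertices, f = {v}) ∨ ∃ e ∈ G.segments, f = segment ℝ e.1 e.2}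

/-- The local feature size at `x`: the radius of the smallest disk centred at `x` that meets two
nonadjacent (that is, disjoint) features. -/
noncomputable def lfs (G : PSLG) (x : Plane) : ℝ :=
  sInf {r : ℝ | ∃ f ∈ G.features, ∃ g ∈ G.features, Disjoint f g ∧
    (Metric.closedBall x r ∩ f).Nonempty ∧ (Metric.closedBall x r ∩ g).Nonempty}

/-- `S` is the vertex set of a splitting of the PSLG: it contains all vertices, and all of its
other points are points of segments, at which these segments are split. -/
def IsSplitting (G : PSLG) (S : Finset Plane) : Prop :=
  G.vertices ⊆ S ∧ ∀ v ∈ S, v ∈ G.vertices ∨ ∃ e ∈ G.segments, v ∈ segment ℝ e.1 e.2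

/-- `p q` is a subsegment of the PSLG split at the points of `S`: it joins two consecutive points
of `S` on a segment. -/
def IsSubsegment (G : PSLG) (S : Finset Plane) (p q : Plane) : Prop :=
  p ∈ S ∧ q ∈ S ∧ p ≠ q ∧
    (∃ e ∈ G.segments, p ∈ segment ℝ e.1 e.2 ∧ q ∈ segment ℝ e.1 e.2) ∧
    ∀ v ∈ S, v ∈ segment ℝ p q → v = p ∨ v = q

/-- The lengths of the subsegments are proportional to the local feature size at their endpoints,
with constants `A` and `B`. Being a subsegment is symmetric in `p` and `q`, so the
condition concerns both endpoints of each subsegment. -/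
def SizeBounds (G : PSLG) (S : Finset Plane) (A B : ℝ) : Prop :=
  ∀ p q, G.IsSubsegment S p q → A ≤ G.lfs p / dist p q ∧ G.lfs p / dist p q ≤ B

/-- With `R = B / A`, a small angle is an angle at most `arccos (1 / (2 R))` between two segments
with a common endpoint; the PSLG has none. -/
def NoSmallAngle (G : PSLG) (A B : ℝ) : Prop :=
  ∀ o x y, x ≠ y → G.Joins o x → G.Joins o y →
    Real.arccos (1 / (2 * (B / A))) < EuclideanGeometry.angle x o y

end PSLG

/-- `T` is (the set of triangles, given by their vertices, of) a Delaunay triangulation of the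
finite point set `S`. -/
structure IsDelaunayTriangulation (S : Finset Plane) (T : Set (Finset Plane)) : Prop where
  subset : ∀ t ∈ T, t ⊆ S
  card : ∀ t ∈ T, t.card = 3
  nondegenerate : ∀ t ∈ T, AffineIndependent ℝ ((↑) : t → Plane)
  inter : ∀ t ∈ T, ∀ t' ∈ T, convexHull ℝ (t : Set Plane) ∩ convexHull ℝ (t' : Set Plane) ⊆
    convexHull ℝ ((t : Set Plane) ∩ (t' : Set Plane))
  cover : ⋃ t ∈ T, convexHull ℝ (t : Set Plane) = convexHull ℝ (S : Set Plane)
  empty_circumcircle : ∀ t ∈ T, ∀ (c : Plane) (r : ℝ), (∀ x ∈ t, dist x c = r) →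
    ∀ v ∈ S, r ≤ dist v c

/-- A triangle is skinny if its minimum angle is less than `θ`. -/
def IsSkinny (θ : ℝ) (t : Finset Plane) : Prop :=
  ∃ x ∈ t, ∃ y ∈ t, ∃ z ∈ t, x ≠ y ∧ y ≠ z ∧ x ≠ z ∧ EuclideanGeometry.angle x y z < θ

/-- `c` is the circumcenter of the triangle `p q o`. -/
def IsCircumcenter (p q o c : Plane) : Prop :=
  dist c p = dist c q ∧ dist c p = dist c o

/-- `r` is the off-center of the triangle `p q o` with shortest edge `p q`: the point of the
perpendicular bisector of `p q`, on the same side of `p q` as `o`, at which `p q` subtends the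
angle `θ`. -/
def IsOffCenter (θ : ℝ) (p q o r : Plane) : Prop :=
  dist r p = dist r q ∧ EuclideanGeometry.angle p r q = θ ∧
    (affineSpan ℝ {p, q}).SSameSide r o

/-- `a` is the Steiner vertex of the triangle `p q o` with shortest edge `p q`: its off-center or
its circumcenter, whichever is closer to `p q`. (Both lie on the perpendicular bisector of `p q`,
so the distance to `p q` is the distance to the midpoint.) -/
def IsSteinerPoint (θ : ℝ) (p q o a : Plane) : Prop :=
  ∃ c r, IsCircumcenter p q o c ∧ IsOffCenter θ p q o r ∧
    ((dist r (midpoint ℝ p q) ≤ dist c (midpoint ℝ p q) ∧ a = r) ∨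
      (dist c (midpoint ℝ p q) < dist r (midpoint ℝ p q) ∧ a = c))

/-- One step of the refinement of the truly Delaunay mesh of the region `Ω` with vertex set `S`:
among the skinny triangles in `Ω` of a Delaunay triangulation of `S`, the triangle `t` has the
shortest shortest edge `p q`, and `a` is the Steiner vertex of `t`. -/
def Inserts (θ : ℝ) (Ω : Set Plane) (S : Finset Plane) (t : Finset Plane) (a : Plane) : Prop :=
  ∃ T, IsDelaunayTriangulation S T ∧
    t ∈ T ∧ IsSkinny θ t ∧ convexHull ℝ (t : Set Plane) ⊆ Ω ∧
    ∃ p q o, (t : Set Plane) = {p, q, o} ∧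
      (∀ t' ∈ T, IsSkinny θ t' → convexHull ℝ (t' : Set Plane) ⊆ Ω →
        ∀ x ∈ t', ∀ y ∈ t', x ≠ y → dist p q ≤ dist x y) ∧
      IsSteinerPoint θ p q o a

open Classical in
/-- The vertex sets that occur when the refinement starts from the vertex set `S₀`. -/
inductive Reachable (θ : ℝ) (Ω : Set Plane) (S₀ : Finset Plane) : Finset Plane → Prop
  | start : Reachable θ Ω S₀ S₀
  | step {S t : Finset Plane} {a : Plane} :
      Reachable θ Ω S₀ S → Inserts θ Ω S t a → Reachable θ Ω S₀ (insert a S)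

/-- The closed disk bounded by the diametral circle of `p q`. -/
noncomputable def diametralDisk (p q : Plane) : Set Plane :=
  Metric.closedBall (midpoint ℝ p q) (dist p q / 2)

/-- The Steiner vertex `a` of the triangle `t` encroaches upon `p q`: the subsegment `p q`
separates `a` from the triangle, in that it is met on the way from some interior point
of the triangle to `a`. -/
def Encroaches (t : Finset Plane) (a p q : Plane) : Prop :=
  ∃ x ∈ interior (convexHull ℝ (t : Set Plane)), (segment ℝ x a ∩ segment ℝ p q).Nonempty

/-! The proof carries a spacing invariant through the refinement: with `C = B + α / (α - 1)`, any
two distinct vertices at distance d include one whose local feature size is at most C d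
(`PSLG.IsSpaced`).

For the initial points (`PSLG.lfs_le_of_mem_splitting`) the constant `B` suffices: points on
disjoint features are at least a local feature size apart, points on one segment are separated by a
subsegment, and on two segments with a common endpoint the angle is at least 60 degrees, so the
distance is at least that of one of the points to the common endpoint.

For a Steiner vertex a, let E be the length of the shortest edge uv and D = |au| = |av|. The
function LFS is 1-Lipschitz, so LFS(a) ≤ C E + D by the invariant at u, v. The empty circumdisk
keeps every vertex x so far from a that C E + D ≤ C |ax| (`Inserts.exists_edge`), because C (1 - 2
sin θ) ≥ 1. Hence C is preserved.

At an endpoint p of a subsegment pq, the invariant gives A |pq| ≤ LFS(p) ≤ (C + 1) |zp| for every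
other vertex z. Since C + 1 < √2 A, both |zp| and |zq| exceed |pq| / √2, so z sees pq at an acute
angle and lies outside the diametral disk. This holds for a too. Finally, a lies inside the
circumdisk of t, which has neither p nor q in its interior. If pq cuts this disk, the cap beyond pq
is contained in the diametral disk, so a and the triangle are on the same side of pq
(`segment_inter_segment_eq_empty`). -/

open scoped RealInnerProductSpace

/-! ### Caps of disks and diametral disks -/

section Disk

variable {V : Type*} [NormedAddCommGroup V] [InnerProductSpace ℝ V]

/-- A quadratic polynomial that is nonnegative at `0` and `1` and negative in between is positive
outside `[0, 1]`. -/
theorem mem_Icc_of_quadratic_nonpos {α β γ s t : ℝ} (hα : 0 ≤ α) (h0 : 0 ≤ γ)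
    (h1 : 0 ≤ α + β + γ) (hs0 : 0 ≤ s) (hs1 : s ≤ 1) (hs : α * s ^ 2 + β * s + γ < 0)
    (ht : α * t ^ 2 + β * t + γ ≤ 0) : 0 ≤ t ∧ t ≤ 1 := by
  constructor
  · by_contra! h
    have key : (s - t) * γ = s * (α * t ^ 2 + β * t + γ) + (-t) * (α * s ^ 2 + β * s + γ)
        + α * s * t * (s - t) := by ring
    have e1 : 0 ≤ (s - t) * γ := mul_nonneg (by linarith) h0
    have e2 : s * (α * t ^ 2 + β * t + γ) ≤ 0 := mul_nonpos_of_nonneg_of_nonpos hs0 ht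
    have e3 : (-t) * (α * s ^ 2 + β * s + γ) < 0 := mul_neg_of_pos_of_neg (by linarith) hs
    have e4 : α * s * t * (s - t) ≤ 0 :=
      mul_nonpos_of_nonpos_of_nonneg
        (mul_nonpos_of_nonneg_of_nonpos (mul_nonneg hα hs0) h.le) (by linarith)
    linarith
  · by_contra! h
    have key : (t - s) * (α + β + γ) = (1 - s) * (α * t ^ 2 + β * t + γ)
        + (t - 1) * (α * s ^ 2 + β * s + γ) - α * (1 - s) * (t - 1) * (t - s) := by ring
    have e1 : 0 ≤ (t - s) * (α + β + γ) := mul_nonneg (by linarith) h1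
    have e2 : (1 - s) * (α * t ^ 2 + β * t + γ) ≤ 0 :=
      mul_nonpos_of_nonneg_of_nonpos (by linarith) ht
    have e3 : (t - 1) * (α * s ^ 2 + β * s + γ) < 0 := mul_neg_of_pos_of_neg (by linarith) hs
    have e4 : 0 ≤ α * (1 - s) * (t - 1) * (t - s) :=
      mul_nonneg (mul_nonneg (mul_nonneg hα (by linarith)) (by linarith)) (by linarith)
    linarith

/-- If a ball that does not contain `0` and `u` meets the segment between them, then its part
beyond the line through `0` and `u`, as seen from its centre `c`, lies in the ball with
diameter `0 u`. -/
theorem inner_le_zero_of_cap {u c w : V} {r t s : ℝ} (h0 : r ≤ ‖c‖) (h1 : r ≤ ‖u - c‖)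
    (hs0 : 0 ≤ s) (hs1 : s ≤ 1) (hs : ‖s • u - c‖ < r) (hw : ⟪u, w⟫ = 0) (hcw : ⟪c, w⟫ ≤ 0)
    (hz : ‖t • u + w - c‖ ≤ r) : ⟪t • u + w, t • u + w - u⟫ ≤ 0 := by
  have hr : 0 ≤ r := (norm_nonneg _).trans hz
  have expand (τ : ℝ) : ‖τ • u - c‖ ^ 2 = ‖u‖ ^ 2 * τ ^ 2 + (-2 * ⟪u, c⟫) * τ + ‖c‖ ^ 2 := by
    rw [norm_sub_sq_real, norm_smul, inner_smul_left, mul_pow, Real.norm_eq_abs, sq_abs]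
    simp; ring
  have h0' : r ^ 2 ≤ ‖c‖ ^ 2 := pow_le_pow_left₀ hr h0 2
  have h1' : r ^ 2 ≤ ‖u - c‖ ^ 2 := pow_le_pow_left₀ hr h1 2
  have hs' : ‖s • u - c‖ ^ 2 < r ^ 2 := pow_lt_pow_left₀ hs (norm_nonneg _) two_ne_zero
  have hz' : ‖t • u + w - c‖ ^ 2 ≤ r ^ 2 := pow_le_pow_left₀ (norm_nonneg _) hz 2
  have hu := expand 1
  rw [one_smul] at hu
  have hz2 : ‖t • u + w - c‖ ^ 2 = ‖t • u - c‖ ^ 2 - 2 * ⟪c, w⟫ + ‖w‖ ^ 2 := by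
    rw [show t • u + w - c = (t • u - c) + w by abel, norm_add_sq_real, inner_sub_left,
      inner_smul_left, hw]
    simp; ring
  have hw0 : 0 ≤ ‖w‖ ^ 2 := sq_nonneg _
  rw [expand] at hs' hz2
  obtain ⟨ht0, ht1⟩ := mem_Icc_of_quadratic_nonpos (α := ‖u‖ ^ 2) (β := -2 * ⟪u, c⟫)
    (γ := ‖c‖ ^ 2 - r ^ 2) (s := s) (t := t) (sq_nonneg _) (by linarith) (by linarith) hs0 hs1
    (by linarith) (by linarith)
  have hg : ⟪t • u + w, t • u + w - u⟫ = t * (t - 1) * ‖u‖ ^ 2 + ‖w‖ ^ 2 := by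
    have hw' : ⟪w, u⟫ = 0 := by rw [real_inner_comm, hw]
    simp only [inner_add_left, inner_sub_right, inner_add_right, inner_smul_left,
      inner_smul_right, hw, hw', real_inner_self_eq_norm_sq]
    simp; ring
  -- Weighting the conditions at the two endpoints by 1 - t and t gives ‖t u - c‖² ≥ r² - t (1 - t)
  -- ‖u‖², which bounds ‖w‖² by t (1 - t) ‖u‖².
  have e1 : 0 ≤ (1 - t) * (‖c‖ ^ 2 - r ^ 2) := mul_nonneg (by linarith) (by linarith)
  have e2 : 0 ≤ t * (‖u - c‖ ^ 2 - r ^ 2) := mul_nonneg ht0 (by linarith)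
  rw [hu] at e2
  rw [hg]
  linarith

/-- A point of a convex set `K` inscribed in a ball cannot see a point `a` of the ball across
a segment `p q` whose endpoints are not in the ball, if `a` and the vertices of `K` other than `p`
and `q` are outside the ball with diameter `p q`. -/
theorem segment_inter_segment_eq_empty {t : Set V} {p q a c x : V} {r : ℝ}
    (hp : r ≤ dist p c) (hq : r ≤ dist q c) (ht : ∀ z ∈ t, dist z c = r) (ha : dist a c < r)
    (hag : 0 < ⟪a - p, a - q⟫) (htg : ∀ z ∈ t, z ≠ p → z ≠ q → 0 < ⟪z - p, z - q⟫)
    (hx : x ∈ interior (convexHull ℝ t)) : segment ℝ x a ∩ segment ℝ p q = ∅ := by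
  rw [Set.eq_empty_iff_forall_notMem]
  rintro y ⟨hyx, hyp⟩
  have hr : 0 < r := dist_nonneg.trans_lt ha
  have hK : convexHull ℝ t ⊆ Metric.closedBall c r :=
    convexHull_min (fun z hz => (ht z hz).le) (convex_closedBall c r)
  have hxb : x ∈ Metric.ball c r := by
    rw [← interior_closedBall c hr.ne']
    exact interior_mono hK hx
  have hyc : dist y c < r := (convex_ball c r).segment_subset hxb ha hyx
  have hpq : p ≠ q := by
    rintro rfl
    rw [segment_same, Set.mem_singleton_iff] at hyp
    exact absurd hyc (not_lt.2 (hyp ▸ hp))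
  set u := q - p with hu
  have hu0 : u ≠ 0 := sub_ne_zero.2 hpq.symm
  have huu : ‖u‖ ^ 2 ≠ 0 := by simpa using hu0
  obtain ⟨s, ⟨hs0, hs1⟩, rfl⟩ := (segment_eq_image' ℝ p q ▸ hyp :)
  -- The component of c - p normal to the line pq, pointing to the side of the centre. If c is on
  -- the line, then n = 0 and `side` still applies, so that `hψa` is contradictory.
  set n := (c - p) - (⟪u, c - p⟫ / ‖u‖ ^ 2) • u with hn
  have hun : ⟪u, n⟫ = 0 := by
    rw [hn, inner_sub_right, inner_smul_right, real_inner_self_eq_norm_sq]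
    field_simp; ring
  have side (z : V) (hz : dist z c ≤ r) (hzg : 0 < ⟪z - p, z - q⟫) : 0 < ⟪n, z - p⟫ := by
    by_contra! hneg
    set τ := ⟪u, z - p⟫ / ‖u‖ ^ 2 with hτ
    set w := (z - p) - τ • u with hw
    have huw : ⟪u, w⟫ = 0 := by
      rw [hw, inner_sub_right, inner_smul_right, real_inner_self_eq_norm_sq, hτ]
      field_simp; ring
    have hcw : ⟪c - p, w⟫ = ⟪n, z - p⟫ := by
      have e1 : c - p = n + (⟪u, c - p⟫ / ‖u‖ ^ 2) • u := by rw [hn]; abel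
      have e2 : z - p = w + τ • u := by rw [hw]; abel
      rw [e1, e2, inner_add_left, inner_smul_left, huw, inner_add_right, inner_smul_right,
        real_inner_comm u n, hun]
      simp
    have e3 : τ • u + w = z - p := by rw [hw]; abel
    have := inner_le_zero_of_cap (u := u) (c := c - p) (w := w) (r := r) (t := τ) (s := s)
      (by rw [← dist_eq_norm, dist_comm]; exact hp)
      (by rw [hu, sub_sub_sub_cancel_right, ← dist_eq_norm]; exact hq) hs0 hs1
      (by
        rw [dist_eq_norm] at hyc
        rwa [show s • u - (c - p) = p + s • (q - p) - c by rw [hu]; abel])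
      huw (hcw ▸ hneg)
      (by rw [e3, sub_sub_sub_cancel_right, ← dist_eq_norm]; exact hz)
    rw [e3, hu, sub_sub_sub_cancel_right] at this
    linarith
  have hψa := side a ha.le hag
  have hψt : convexHull ℝ t ⊆ {z | 0 ≤ ⟪n, z - p⟫} := by
    refine convexHull_min (fun z hz => ?_) ?_
    · by_cases h1 : z = p
      · simp [h1]
      by_cases h2 : z = q
      · simp [h2, ← hu, real_inner_comm u n, hun]
      exact (side z (ht z hz).le (htg z hz h1 h2)).le
    · have : {z | 0 ≤ ⟪n, z - p⟫} = {z | ⟪n, p⟫ ≤ ⟪n, z⟫} := by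
        ext z; simp [inner_sub_right]
      rw [this]
      exact convex_halfSpace_ge (innerₛₗ ℝ n).isLinear _
  -- The functional vanishes at the crossing point, is nonnegative at x and positive at a. The
  -- crossing point is not a itself, so x has positive weight and must lie on the zero set.
  have hψx : ⟪n, x - p⟫ = 0 := by
    refine le_antisymm ?_ (hψt (interior_subset hx))
    obtain ⟨α, β, hα, hβ, hαβ, hy⟩ := hyx
    have e1 : α • (x - p) + β • (a - p) = s • u := by
      have : α • (x - p) + β • (a - p) = (α • x + β • a) - (α + β) • p := by module
      rw [this, hy, hαβ, one_smul, hu, add_sub_cancel_left]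
    have e2 := congrArg (fun v => ⟪n, v⟫) e1
    simp only [inner_add_right, inner_smul_right, real_inner_comm u n, hun, mul_zero] at e2
    have hx0 : 0 ≤ ⟪n, x - p⟫ := hψt (interior_subset hx)
    have hα0 : α ≠ 0 := by
      rintro rfl
      have : β = 1 := by linarith
      subst this
      linarith
    have hα1 : 0 < α := lt_of_le_of_ne hα hα0.symm
    by_contra! h
    have := mul_pos hα1 h
    have := mul_nonneg hβ hψa.le
    linarith
  have hn0 : n ≠ 0 := by
    rintro h
    simp [h] at hψa
  -- An interior point of the hull can be moved slightly along -n, which would leave the half-space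
  -- containing the hull.
  have hcont : Filter.Tendsto (fun ε : ℝ => x - ε • n) (nhdsWithin 0 (Set.Ioi 0)) (nhds x) := by
    have : Continuous fun ε : ℝ => x - ε • n := by fun_prop
    simpa using (this.tendsto 0).mono_left nhdsWithin_le_nhds
  obtain ⟨ε, hε, hε0⟩ := ((hcont.eventually (mem_interior_iff_mem_nhds.1 hx)).and
    self_mem_nhdsWithin).exists
  have h1 : 0 ≤ ⟪n, x - ε • n - p⟫ := hψt hε
  rw [show x - ε • n - p = (x - p) - ε • n by abel, inner_sub_right, hψx, inner_smul_right,
    real_inner_self_eq_norm_sq] at h1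
  have := mul_pos (show 0 < ε from hε0) (pow_pos (norm_pos_iff.2 hn0) 2)
  linarith

/-- The ball with diameter `p q` is characterized by the angle at which `p q` is seen. -/
theorem inner_sub_sub_pos_of_dist {z p q : V} (hp : dist p q / √2 < dist z p)
    (hq : dist p q / √2 < dist z q) : 0 < ⟪z - p, z - q⟫ := by
  have h1 : ‖p - q‖ ^ 2 = ‖z - q‖ ^ 2 - 2 * ⟪z - q, z - p⟫ + ‖z - p‖ ^ 2 := by
    rw [← norm_sub_sq_real]
    congr 2; abel
  have hh : (dist p q / √2) ^ 2 = dist p q ^ 2 / 2 := by rw [div_pow, Real.sq_sqrt (by norm_num)]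
  have h2 := pow_lt_pow_left₀ hp (by positivity) two_ne_zero
  have h3 := pow_lt_pow_left₀ hq (by positivity) two_ne_zero
  rw [hh] at h2 h3
  rw [dist_eq_norm, dist_eq_norm] at h2 h3
  rw [real_inner_comm]
  linarith

theorem notMem_closedBall_of_inner_pos {z p q : V} (h : 0 < ⟪z - p, z - q⟫) :
    z ∉ Metric.closedBall (midpoint ℝ p q) (dist p q / 2) := by
  intro hz
  rw [Metric.mem_closedBall] at hz
  have h0 := EuclideanGeometry.dist_sq_add_dist_sq_eq_two_mul_dist_midpoint_sq_add_half_dist_sq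
    z p q
  have h1 : ‖p - q‖ ^ 2 = ‖z - q‖ ^ 2 - 2 * ⟪z - q, z - p⟫ + ‖z - p‖ ^ 2 := by
    rw [← norm_sub_sq_real]
    congr 2; abel
  have h2 := pow_le_pow_left₀ dist_nonneg hz 2
  rw [real_inner_comm] at h
  rw [← dist_eq_norm, ← dist_eq_norm, ← dist_eq_norm] at h1
  linarith

end Disk

/-! ### Local feature size and the spacing of the initial points -/

namespace PSLG

variable {G : PSLG}

theorem lfs_le_lfs_add_dist (G : PSLG) (x y : Plane) : G.lfs x ≤ G.lfs y + dist x y := by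
  have hbdd (z : Plane) : BddBelow {r : ℝ | ∃ f ∈ G.features, ∃ g ∈ G.features, Disjoint f g ∧
      (Metric.closedBall z r ∩ f).Nonempty ∧ (Metric.closedBall z r ∩ g).Nonempty} := by
    refine ⟨0, ?_⟩
    rintro r ⟨f, -, g, -, -, ⟨v, hv, -⟩, -⟩
    exact dist_nonneg.trans (Metric.mem_closedBall.1 hv)
  rcases Set.eq_empty_or_nonempty {r : ℝ | ∃ f ∈ G.features, ∃ g ∈ G.features, Disjoint f g ∧
      (Metric.closedBall y r ∩ f).Nonempty ∧ (Metric.closedBall y r ∩ g).Nonempty} with h | h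
  -- Without two disjoint features both infima are over the empty set and equal 0.
  · have hx : {r : ℝ | ∃ f ∈ G.features, ∃ g ∈ G.features, Disjoint f g ∧
        (Metric.closedBall x r ∩ f).Nonempty ∧ (Metric.closedBall x r ∩ g).Nonempty} = ∅ := by
      rw [Set.eq_empty_iff_forall_notMem] at h ⊢
      rintro r ⟨f, hf, g, hg, hd, h1, h2⟩
      have hsub := Metric.closedBall_subset_closedBall' (ε₁ := r) (ε₂ := r + dist x y) (x := x)
        (y := y) le_rfl
      exact h (r + dist x y) ⟨f, hf, g, hg, hd, h1.mono (Set.inter_subset_inter_left _ hsub),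
        h2.mono (Set.inter_subset_inter_left _ hsub)⟩
    simp only [lfs, h, hx, Real.sInf_empty, zero_add]
    exact dist_nonneg
  · rw [← sub_le_iff_le_add]
    refine le_csInf h ?_
    rintro r ⟨f, hf, g, hg, hd, h1, h2⟩
    rw [sub_le_iff_le_add]
    have hsub := Metric.closedBall_subset_closedBall' (ε₁ := r) (ε₂ := r + dist x y) (x := y)
      (y := x) (by rw [dist_comm y x])
    exact csInf_le (hbdd x) ⟨f, hf, g, hg, hd, h1.mono (Set.inter_subset_inter_left _ hsub),
      h2.mono (Set.inter_subset_inter_left _ hsub)⟩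

theorem lfs_le_dist {f g : Set Plane} (hf : f ∈ G.features) (hg : g ∈ G.features)
    (hd : Disjoint f g) {u v : Plane} (hu : u ∈ f) (hv : v ∈ g) : G.lfs u ≤ dist u v := by
  refine csInf_le ⟨0, ?_⟩ ⟨f, hf, g, hg, hd, ⟨u, ?_, hu⟩, ⟨v, ?_, hv⟩⟩
  · rintro r ⟨f, -, g, -, -, ⟨v, hv, -⟩, -⟩
    exact dist_nonneg.trans (Metric.mem_closedBall.1 hv)
  · simp
  · simp [dist_comm]

theorem dist_le_of_mem_segment {u v x : Plane} (hx : x ∈ segment ℝ u v) :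
    dist u x ≤ dist u v := by
  have := dist_add_dist_of_mem_segment hx
  have := dist_nonneg (x := x) (y := v)
  linarith

/-- Between two points of a splitting on one segment there is a subsegment starting at the
first of them. -/
theorem exists_isSubsegment {S : Finset Plane} {e : Plane × Plane} (he : e ∈ G.segments)
    {u v : Plane} (hu : u ∈ S) (hv : v ∈ S) (huv : u ≠ v) (hue : u ∈ segment ℝ e.1 e.2)
    (hve : v ∈ segment ℝ e.1 e.2) : ∃ w, G.IsSubsegment S u w ∧ dist u w ≤ dist u v := by
  classical
  -- The witness is the point of `S` on the segment from u to v that is nearest to u.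
  obtain ⟨w, hw, hmin⟩ := (S.filter fun w => w ∈ segment ℝ u v ∧ w ≠ u).exists_min_image
    (fun w => dist u w) ⟨v, by simp [hv, huv.symm, right_mem_segment]⟩
  rw [Finset.mem_filter] at hw
  obtain ⟨hwS, hwuv, hwu⟩ := hw
  have hconv := convex_segment (𝕜 := ℝ) e.1 e.2
  have huve := hconv.segment_subset hue hve
  refine ⟨w, ⟨hu, hwS, hwu.symm, ⟨e, he, hue, huve hwuv⟩, ?_⟩, dist_le_of_mem_segment hwuv⟩
  intro x hx hxuw
  by_cases hxu : x = u
  · exact Or.inl hxu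
  right
  have h1 := hmin x (by
    rw [Finset.mem_filter]
    exact ⟨hx, (convex_segment (𝕜 := ℝ) u v).segment_subset (left_mem_segment ℝ u v) hwuv hxuw,
      hxu⟩)
  have h2 := dist_add_dist_of_mem_segment hxuw
  exact dist_le_zero.1 (by linarith)

theorem lfs_le_of_mem_segment {S : Finset Plane} {A B : ℝ} (hAB : G.SizeBounds S A B)
    (hB : 0 ≤ B) {e : Plane × Plane} (he : e ∈ G.segments)
    {u v : Plane} (hu : u ∈ S) (hv : v ∈ S) (huv : u ≠ v) (hue : u ∈ segment ℝ e.1 e.2)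
    (hve : v ∈ segment ℝ e.1 e.2) : G.lfs u ≤ B * dist u v := by
  obtain ⟨w, hw, hle⟩ := exists_isSubsegment he hu hv huv hue hve
  have h := (hAB u w hw).2
  rw [div_le_iff₀ (dist_pos.2 hw.2.2.1)] at h
  exact h.trans (mul_le_mul_of_nonneg_left hle hB)

/-- The sides of an angle of at least `60` degrees are not both longer than the opposite side. -/
theorem norm_le_norm_sub {x y : Plane} (h : 2 * ⟪x, y⟫ ≤ ‖x‖ * ‖y‖) (hxy : ‖y‖ ≤ ‖x‖) :
    ‖y‖ ≤ ‖x - y‖ := by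
  refine le_of_sq_le_sq ?_ (norm_nonneg _)
  rw [norm_sub_sq_real]
  nlinarith [norm_nonneg x, norm_nonneg y]

theorem exists_joins_of_mem_segment {e : Plane × Plane} (he : e ∈ G.segments) {o u : Plane}
    (ho : o = e.1 ∨ o = e.2) (hu : u ∈ segment ℝ e.1 e.2) :
    ∃ x, G.Joins o x ∧ segment ℝ o x = segment ℝ e.1 e.2 ∧
      ∃ s : ℝ, 0 ≤ s ∧ u - o = s • (x - o) := by
  rcases ho with rfl | rfl
  · refine ⟨e.2, Or.inl he, rfl, ?_⟩
    rw [segment_eq_image'] at hu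
    obtain ⟨s, ⟨hs, -⟩, rfl⟩ := hu
    exact ⟨s, hs, by simp⟩
  · refine ⟨e.1, Or.inr he, segment_symm ℝ _ _, ?_⟩
    rw [segment_symm, segment_eq_image'] at hu
    obtain ⟨s, ⟨hs, -⟩, rfl⟩ := hu
    exact ⟨s, hs, by simp⟩

/-- Since R ≥ 1, the threshold arccos(1 / (2R)) is at least 60 degrees, so the cosine of the angle
is at most 1/2. -/
theorem two_mul_inner_le_of_noSmallAngle {A B : ℝ} (hA : 0 < A) (hAB : A ≤ B)
    (hangle : G.NoSmallAngle A B) {o x y : Plane} (hxy : x ≠ y) (hx : G.Joins o x)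
    (hy : G.Joins o y) : 2 * ⟪x - o, y - o⟫ ≤ ‖x - o‖ * ‖y - o‖ := by
  have h := hangle o x y hxy hx hy
  have hR : 1 ≤ B / A := (one_le_div hA).2 hAB
  have hR' : 1 / (2 * (B / A)) ≤ 1 / 2 := one_div_le_one_div_of_le (by norm_num) (by linarith)
  have hR0 : 0 ≤ 1 / (2 * (B / A)) := by positivity
  have hcos := Real.cos_lt_cos_of_nonneg_of_le_pi (Real.arccos_nonneg _)
    (InnerProductGeometry.angle_le_pi _ _) h
  rw [Real.cos_arccos (by linarith) (by linarith)] at hcos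
  have := InnerProductGeometry.cos_angle_mul_norm_mul_norm (x - o) (y - o)
  rw [← this]
  change Real.cos (InnerProductGeometry.angle (x - o) (y - o)) < _ at hcos
  have hn : 0 ≤ ‖x - o‖ * ‖y - o‖ := by positivity
  nlinarith

/-- The initial points are far apart in terms of the local feature size. -/
theorem lfs_le_of_mem_splitting {S : Finset Plane} {A B : ℝ} (hA : 0 < A) (hAleB : A ≤ B)
    (hB : 1 ≤ B) (hS : G.IsSplitting S) (hAB : G.SizeBounds S A B) (hangle : G.NoSmallAngle A B)
    {u v : Plane} (hu : u ∈ S) (hv : v ∈ S) (huv : u ≠ v) :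
    G.lfs u ≤ B * dist u v ∨ G.lfs v ≤ B * dist u v := by
  have hB0 : 0 ≤ B := by linarith
  have hdist : dist u v ≤ B * dist u v := le_mul_of_one_le_left dist_nonneg hB
  have far {f g : Set Plane} (hf : f ∈ G.features) (hg : g ∈ G.features) (hd : Disjoint f g)
      (huf : u ∈ f) (hvg : v ∈ g) : G.lfs u ≤ B * dist u v ∨ G.lfs v ≤ B * dist u v :=
    Or.inl ((lfs_le_dist hf hg hd huf hvg).trans hdist)
  have same {e : Plane × Plane} (he : e ∈ G.segments) (hue : u ∈ segment ℝ e.1 e.2)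
      (hve : v ∈ segment ℝ e.1 e.2) : G.lfs u ≤ B * dist u v ∨ G.lfs v ≤ B * dist u v :=
    Or.inl (lfs_le_of_mem_segment hAB hB0 he hu hv huv hue hve)
  rcases hS.2 u hu with huV | ⟨e, he, hue⟩
  · rcases hS.2 v hv with hvV | ⟨f, hf, hvf⟩
    · exact far (Or.inl ⟨u, huV, rfl⟩) (Or.inl ⟨v, hvV, rfl⟩) (by simpa using huv) rfl rfl
    · by_cases huf : u ∈ segment ℝ f.1 f.2
      · exact same hf huf hvf
      · exact far (Or.inl ⟨u, huV, rfl⟩) (Or.inr ⟨f, hf, rfl⟩) (by simpa using huf) rfl hvf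
  rcases hS.2 v hv with hvV | ⟨f, hf, hvf⟩
  · by_cases hve : v ∈ segment ℝ e.1 e.2
    · exact same he hue hve
    · exact far (Or.inr ⟨e, he, rfl⟩) (Or.inl ⟨v, hvV, rfl⟩) (by simpa using hve) hue rfl
  by_cases hd : Disjoint (segment ℝ e.1 e.2) (segment ℝ f.1 f.2)
  · exact far (Or.inr ⟨e, he, rfl⟩) (Or.inr ⟨f, hf, rfl⟩) hd hue hvf
  by_cases hef : e = f
  · exact same he hue (hef ▸ hvf)
  obtain ⟨o, hoe, hof⟩ := Set.not_disjoint_iff.1 hd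
  obtain ⟨ho1, ho2⟩ := G.segments_inter e he f hf hef ⟨hoe, hof⟩
  have hoS : o ∈ S := by
    rcases ho1 with h | h
    · exact hS.1 (h ▸ (G.endpoints_mem e he).1)
    · exact hS.1 (h ▸ (G.endpoints_mem e he).2)
  by_cases huo : u = o
  · exact same hf (huo ▸ hof) hvf
  by_cases hvo : v = o
  · exact same he hue (hvo ▸ hoe)
  obtain ⟨x, hox, hxe, s, hs, hus⟩ := exists_joins_of_mem_segment he ho1 hue
  obtain ⟨y, hoy, hyf, s', hs', hvs⟩ := exists_joins_of_mem_segment hf ho2 hvf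
  -- If the far endpoints agreed, the two segments would coincide as sets, and the three distinct
  -- points u, v, o would all be among the two endpoints of e.
  have hxy : x ≠ y := by
    rintro rfl
    have hsub := G.segments_inter e he f hf hef
    rw [← hxe, ← hyf, Set.inter_self] at hsub
    have hu' : u ∈ segment ℝ o x := hxe ▸ hue
    have hv' : v ∈ segment ℝ o x := by rwa [hyf]
    have h1 := (hsub hu').1
    have h2 := (hsub hv').1
    have h3 := (hsub (left_mem_segment ℝ o x)).1
    simp only [Set.mem_insert_iff, Set.mem_singleton_iff] at h1 h2 h3
    grind
  have hin := two_mul_inner_le_of_noSmallAngle hA hAleB hangle hxy hox hoy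
  have huv' : 2 * ⟪u - o, v - o⟫ ≤ ‖u - o‖ * ‖v - o‖ := by
    rw [hus, hvs, inner_smul_left, inner_smul_right, norm_smul, norm_smul, Real.norm_of_nonneg hs,
      Real.norm_of_nonneg hs']
    have := mul_le_mul_of_nonneg_left hin (mul_nonneg hs hs')
    simp only [conj_trivial]
    linarith
  rcases le_total ‖v - o‖ ‖u - o‖ with h | h
  · right
    have := norm_le_norm_sub huv' h
    rw [sub_sub_sub_cancel_right, ← dist_eq_norm, ← dist_eq_norm] at this
    exact (lfs_le_of_mem_segment hAB hB0 hf hv hoS hvo hvf hof).trans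
      (mul_le_mul_of_nonneg_left this hB0)
  · left
    rw [real_inner_comm, mul_comm ‖u - o‖] at huv'
    have := norm_le_norm_sub huv' h
    rw [sub_sub_sub_cancel_right, ← dist_eq_norm, ← dist_eq_norm, dist_comm v u] at this
    exact (lfs_le_of_mem_segment hAB hB0 he hu hoS huo hue hoe).trans
      (mul_le_mul_of_nonneg_left this hB0)

end PSLG

/-! ### Circumcenter, off-center and the estimate for the Steiner vertex -/

/-- The law of sines for a triangle with circumcenter `c`. -/
theorem dist_eq_two_mul_radius_mul_sin {x y z c : Plane} {r : ℝ} (hx : dist x c = r)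
    (hy : dist y c = r) (hz : dist z c = r) (hxy : x ≠ y) (hxz : x ≠ z) (hyz : y ≠ z) :
    dist x z = 2 * r * Real.sin (EuclideanGeometry.angle x y z) := by
  have : Fact (Module.finrank ℝ Plane = 2) := ⟨by simp⟩
  let _ : Module.Oriented ℝ Plane (Fin 2) :=
    ⟨Module.Basis.orientation (Module.finBasisOfFinrankEq ℝ Plane (by simp))⟩
  have h := EuclideanGeometry.Sphere.dist_div_sin_oangle_eq_two_mul_radius (s := ⟨c, r⟩)
    (EuclideanGeometry.mem_sphere.2 hx) (EuclideanGeometry.mem_sphere.2 hy)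
    (EuclideanGeometry.mem_sphere.2 hz) hxy hxz hyz
  rw [← Real.Angle.sin_toReal,
    Real.abs_sin_eq_sin_abs_of_abs_le_pi (Real.Angle.abs_toReal_le_pi _),
    ← EuclideanGeometry.angle_eq_abs_oangle_toReal hxy hyz.symm] at h
  have hr : 0 < r := by
    refine lt_of_le_of_ne (hx ▸ dist_nonneg) fun h0 => hxy ?_
    rw [← h0, dist_eq_zero] at hx hy
    rw [hx, hy]
  -- The sine is nonzero: otherwise the quotient in `h` would be 0 by convention, against r > 0.
  rw [← h, div_mul_cancel₀]
  intro h0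
  rw [h0, div_zero] at h
  change 0 = 2 * r at h
  linarith

/-- In the plane, vectors orthogonal to a common direction are proportional. -/
theorem exists_eq_smul_of_inner_eq_zero {d a b : Plane} (hd : d ≠ 0) (hb : b ≠ 0)
    (had : ⟪a, d⟫ = 0) (hbd : ⟪b, d⟫ = 0) : ∃ k : ℝ, a = k • b := by
  simp only [PiLp.inner_apply, Fin.sum_univ_two, RCLike.inner_apply, conj_trivial] at had hbd
  have hd' : d 0 ≠ 0 ∨ d 1 ≠ 0 := by
    by_contra! h
    exact hd (by ext i; fin_cases i <;> simp [h])
  have hcross : a 0 * b 1 = a 1 * b 0 := by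
    rcases hd' with h | h <;> apply mul_left_cancel₀ h
    · linear_combination b 1 * had - a 1 * hbd
    · linear_combination a 0 * hbd - b 0 * had
  have hb' : b 0 ≠ 0 ∨ b 1 ≠ 0 := by
    by_contra! h
    exact hb (by ext i; fin_cases i <;> simp [h])
  rcases hb' with h | h
  · refine ⟨a 0 / b 0, ?_⟩
    ext i
    fin_cases i
    · simp [h]
    · simp only [Fin.mk_one, PiLp.smul_apply, smul_eq_mul]
      field_simp
      linear_combination -hcross
  · refine ⟨a 1 / b 1, ?_⟩
    ext i
    fin_cases i
    · simp only [Fin.zero_eta, PiLp.smul_apply, smul_eq_mul]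
      field_simp
      linear_combination hcross
    · simp [h]

theorem inner_sub_midpoint_of_dist_eq {u v x : Plane} (h : dist x u = dist x v) :
    ⟪x - midpoint ℝ u v, v - u⟫ = 0 := by
  have h1 : ‖x - u‖ ^ 2 = ‖x - v‖ ^ 2 := by rw [← dist_eq_norm, ← dist_eq_norm, h]
  have e1 : x - midpoint ℝ u v = (1 / 2 : ℝ) • ((x - u) + (x - v)) := by
    rw [midpoint_eq_smul_add, invOf_eq_inv]; module
  have e2 : v - u = (x - u) - (x - v) := by abel
  rw [e1, e2, inner_smul_left, inner_sub_right, inner_add_left, inner_add_left,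
    real_inner_self_eq_norm_sq, real_inner_self_eq_norm_sq, real_inner_comm (x - u) (x - v), h1]
  simp; ring

theorem dist_sq_eq_of_dist_eq {u v x : Plane} (h : dist x u = dist x v) :
    dist x u ^ 2 = dist x (midpoint ℝ u v) ^ 2 + (dist u v / 2) ^ 2 := by
  have := EuclideanGeometry.dist_sq_add_dist_sq_eq_two_mul_dist_midpoint_sq_add_half_dist_sq x u v
  rw [← h] at this
  linarith

/-- The circumcenter and the off-center of a triangle with shortest edge `u v` are on the same
side of that edge. -/
theorem exists_circumcenter_eq_smul {u v o c r : Plane} (huv : u ≠ v) (hou : dist u v ≤ dist o u)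
    (hov : dist u v ≤ dist o v) (hc : dist c u = dist c v) (hco : dist c u = dist c o)
    (hr : dist r u = dist r v) (hside : (affineSpan ℝ {u, v}).SSameSide r o) :
    ∃ k : ℝ, 0 < k ∧ c - midpoint ℝ u v = k • (r - midpoint ℝ u v) := by
  set m := midpoint ℝ u v with hm
  have hd : v - u ≠ 0 := sub_ne_zero.2 huv.symm
  have hms : m ∈ affineSpan ℝ {u, v} :=
    AffineMap.lineMap_mem _ (left_mem_affineSpan_pair ℝ u v) (right_mem_affineSpan_pair ℝ u v)
  have hrm : r - m ≠ 0 := by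
    intro h
    exact hside.2.1 (sub_eq_zero.1 h ▸ hms)
  have hcd := inner_sub_midpoint_of_dist_eq hc
  have hrd := inner_sub_midpoint_of_dist_eq hr
  rw [← hm] at hcd hrd
  obtain ⟨k, hk⟩ := exists_eq_smul_of_inner_eq_zero hd hrm hcd hrd
  refine ⟨k, ?_, hk⟩
  obtain ⟨-, -, p, hp, hray⟩ := (AffineSubspace.sSameSide_iff_exists_left hms).1 hside
  rw [vsub_eq_sub, vsub_eq_sub] at hray
  have hpm : ⟪r - m, p - m⟫ = 0 := by
    obtain ⟨τ, rfl⟩ := mem_affineSpan_pair_iff_exists_lineMap_eq.1 hp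
    have : AffineMap.lineMap u v τ - m = (τ - 1 / 2) • (v - u) := by
      rw [hm, midpoint_eq_smul_add, invOf_eq_inv, AffineMap.lineMap_apply, vsub_eq_sub, vadd_eq_add]
      module
    rw [this, inner_smul_right, hrd, mul_zero]
  have hro : 0 ≤ ⟪r - m, o - m⟫ := by
    have e : o - m = (o - p) + (p - m) := by abel
    rw [e, inner_add_right, hpm, add_zero]
    obtain ⟨a, b, ha, hb, -, h1, h2⟩ := hray.exists_eq_smul_add
    generalize r - m + (o - p) = w at h1 h2
    rw [h1, h2, inner_smul_left, inner_smul_right, real_inner_self_eq_norm_sq]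
    simp only [conj_trivial]
    positivity
  -- Since |co| = |cu|, twice this inner product is |om|² - (|uv|/2)², and |om|² ≥ 3|uv|²/4 because
  -- uv is a shortest edge.
  have hoc : 0 < ⟪c - m, o - m⟫ := by
    have e1 : ‖o - c‖ ^ 2 = ‖o - m‖ ^ 2 - 2 * ⟪o - m, c - m⟫ + ‖c - m‖ ^ 2 := by
      rw [← norm_sub_sq_real, sub_sub_sub_cancel_right]
    have e2 := dist_sq_eq_of_dist_eq hc
    have e3 :=
      EuclideanGeometry.dist_sq_add_dist_sq_eq_two_mul_dist_midpoint_sq_add_half_dist_sq o u v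
    have h1 := pow_le_pow_left₀ dist_nonneg hou 2
    have h2 := pow_le_pow_left₀ dist_nonneg hov 2
    have h3 : 0 < dist u v ^ 2 := pow_pos (dist_pos.2 huv) 2
    rw [← hm] at e2 e3
    rw [hco, dist_comm c o] at e2
    rw [← dist_eq_norm, ← dist_eq_norm, ← dist_eq_norm, real_inner_comm] at e1
    linarith
  rw [hk, inner_smul_left] at hoc
  exact (pos_iff_pos_of_mul_pos hoc).2 (lt_of_le_of_ne hro fun h => by simp [← h] at hoc)

/-- With s = sin(θ/2) and c = cos(θ/2), this reduces the off-center case to the condition on 1 - 2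
sin θ. Multiplication by 1 + c turns 1 - c into s², so that a factor s splits off. -/
theorem sin_cos_half_bound {s c : ℝ} (hs : 0 ≤ s) (hsc : s ^ 2 + c ^ 2 = 1) (hc : 4 / 5 ≤ c) :
    1 - 4 * s * c ≤ c - 2 * s := by
  have hs1 : s ≤ 1 := by nlinarith
  have h1 : 0 ≤ s * (2 * (2 * c - 1) * (1 + c) - s) := mul_nonneg hs (by nlinarith)
  have h2 : (c - 2 * s - (1 - 4 * s * c)) * (1 + c)
      = s * (2 * (2 * c - 1) * (1 + c) - s) := by linear_combination hsc
  rw [← h2] at h1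
  have := nonneg_of_mul_nonneg_left h1 (by linarith)
  linarith

/-- The Steiner vertex `a` of a triangle lies inside its circumcircle, and is far from all vertices
in terms of the length of the shortest edge `u v` and its distance to this edge. -/
theorem Inserts.exists_edge {θ C : ℝ} {Ω : Set Plane} {S t : Finset Plane} {a : Plane}
    (hθ₀ : 0 < θ) (hθ : θ < Real.pi / 6) (hC0 : 0 ≤ C) (hC : 1 ≤ C * (1 - 2 * Real.sin θ))
    (h : Inserts θ Ω S t a) :
    ∃ u ∈ S, ∃ v ∈ S, u ≠ v ∧ dist a u = dist a v ∧
      (∀ x ∈ S, dist a u + C * dist u v ≤ C * dist a x) ∧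
      ∃ (c : Plane) (r : ℝ), (∀ x ∈ t, dist x c = r) ∧ (∀ x ∈ S, r ≤ dist x c) ∧ dist a c < r := by
  obtain ⟨T, hT, htT, hskinny, htΩ, u, v, o, ht, hmin, c, r, ⟨hcuv, hcuo⟩, ⟨hruv, hang, hside⟩,
    hcase⟩ := h
  have mem (x : Plane) : x ∈ t ↔ x = u ∨ x = v ∨ x = o := by
    rw [← Finset.mem_coe, ht]; simp
  classical
  have hdist : u ≠ v ∧ u ≠ o ∧ v ≠ o := by
    have h3 := hT.card t htT
    have htt : t = {u, v, o} := by ext x; simp [mem]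
    rw [htt] at h3
    refine ⟨fun h => ?_, fun h => ?_, fun h => ?_⟩
    · have := Finset.card_le_two (a := v) (b := o)
      rw [h, Finset.insert_eq_of_mem (by simp)] at h3
      lia
    · have := Finset.card_le_two (a := v) (b := o)
      rw [h, Finset.insert_eq_of_mem (by simp)] at h3
      lia
    · have := Finset.card_le_two (a := u) (b := o)
      rw [h, Finset.insert_eq_of_mem (a := o) (by simp)] at h3
      lia
  obtain ⟨huv, huo, hvo⟩ := hdist
  have hut : u ∈ t := (mem u).2 (by simp)
  have hvt : v ∈ t := (mem v).2 (by simp)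
  have hot : o ∈ t := (mem o).2 (by simp)
  -- Minimality applied to t itself: uv is a shortest edge of t.
  have hshort := hmin t htT hskinny htΩ
  set E := dist u v with hE
  set m := midpoint ℝ u v with hm
  set ρ := dist c u with hρ
  have hEpos : 0 < E := dist_pos.2 huv
  have hcirc : ∀ x ∈ t, dist x c = ρ := by
    intro x hx
    rw [dist_comm]
    rcases (mem x).1 hx with rfl | rfl | rfl
    · rfl
    · exact hcuv.symm
    · exact hcuo.symm
  have hempty := hT.empty_circumcircle t htT c ρ hcirc
  have hρm := dist_sq_eq_of_dist_eq hcuv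
  rw [← hE, ← hm, ← hρ] at hρm
  have hρ0 : 0 < ρ := by
    refine lt_of_le_of_ne dist_nonneg fun h0 => ?_
    rw [← h0] at hρm
    nlinarith [sq_nonneg (dist c m)]
  refine ⟨u, hT.subset t htT hut, v, hT.subset t htT hvt, huv, ?_⟩
  rcases hcase with ⟨hle, rfl⟩ | ⟨hlt, rfl⟩
  · obtain ⟨k, hk0, hk⟩ := exists_circumcenter_eq_smul huv
      (by rw [dist_comm o u]; exact hshort u hut o hot huo)
      (by rw [dist_comm o v]; exact hshort v hvt o hot hvo) hcuv hcuo hruv hside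
    set h := dist a m with hh
    have hcm : dist c m = k * h := by
      rw [dist_eq_norm, hk, norm_smul, Real.norm_of_nonneg hk0.le, ← dist_eq_norm]
    have ham := dist_sq_eq_of_dist_eq hruv
    rw [← hE, ← hm, ← hh] at ham
    set D := dist a u with hD
    have hD0 : 0 < D := by
      refine lt_of_le_of_ne dist_nonneg fun h0 => ?_
      rw [← h0] at ham
      nlinarith [sq_nonneg h]
    -- the isosceles triangle with apex `a`
    have hcosθ : E ^ 2 = 2 * D ^ 2 - 2 * D ^ 2 * Real.cos θ := by
      have := EuclideanGeometry.law_cos u a v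
      rw [hang, dist_comm u a, dist_comm v a, ← hruv] at this
      rw [hE, hD]
      linarith
    have hsD : E = 2 * D * Real.sin (θ / 2) := by
      have hc2 : Real.cos θ = 1 - 2 * Real.sin (θ / 2) ^ 2 := by
        have := Real.cos_two_mul (θ / 2)
        have h2 := Real.sin_sq_add_cos_sq (θ / 2)
        rw [mul_div_cancel₀ _ two_ne_zero] at this
        linarith
      have hs2 : 0 ≤ Real.sin (θ / 2) :=
        Real.sin_nonneg_of_nonneg_of_le_pi (by linarith) (by linarith [Real.pi_pos])
      refine (pow_left_inj₀ hEpos.le (by positivity) two_ne_zero).1 ?_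
      rw [hcosθ, hc2]; ring
    have hcos0 : 4 / 5 ≤ Real.cos (θ / 2) := by
      have h1 : Real.cos (Real.pi / 6) ≤ Real.cos (θ / 2) :=
        Real.cos_le_cos_of_nonneg_of_le_pi (by linarith) (by linarith [Real.pi_pos]) (by linarith)
      rw [Real.cos_pi_div_six] at h1
      have : 8 / 5 ≤ √3 := Real.le_sqrt_of_sq_le (by norm_num)
      linarith
    have hh0 : 0 ≤ h := dist_nonneg
    have hhD : h = D * Real.cos (θ / 2) := by
      refine (pow_left_inj₀ hh0 (by positivity) two_ne_zero).1 ?_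
      have := Real.sin_sq_add_cos_sq (θ / 2)
      rw [hsD] at ham
      linear_combination -ham - D ^ 2 * this
    have hhpos : 0 < h := hhD ▸ by positivity
    have hk1 : 1 ≤ k := by
      rw [hcm] at hle
      exact le_of_mul_le_mul_right (by linarith) hhpos
    have hac : dist a c = (k - 1) * h := by
      have : c - a = (k - 1) • (a - m) := by
        rw [sub_smul, one_smul, ← hk]; abel
      rw [dist_comm, dist_eq_norm, this, norm_smul, Real.norm_of_nonneg (by linarith),
        ← dist_eq_norm]
    have hρk : k * h ≤ ρ := by
      refine le_of_sq_le_sq ?_ hρ0.le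
      rw [hcm] at hρm
      nlinarith
    refine ⟨hruv, fun x hx => ?_, c, ρ, hcirc, hempty, by rw [hac]; linarith⟩
    -- The points m, a, c lie in this order on a ray, and the circumradius is at least |cm| = k h.
    -- Going from c to a costs (k - 1) h, which leaves h.
    have hx' : h ≤ dist a x := by
      have h1 := hempty x hx
      have h2 := dist_triangle x a c
      rw [hac, dist_comm x a] at h2
      linarith
    refine le_trans ?_ (mul_le_mul_of_nonneg_left hx' hC0)
    rw [← hE, hhD, hsD]
    have hs0 : 0 ≤ Real.sin (θ / 2) :=
      Real.sin_nonneg_of_nonneg_of_le_pi (by linarith) (by linarith [Real.pi_pos])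
    have key := sin_cos_half_bound hs0 (Real.sin_sq_add_cos_sq (θ / 2)) hcos0
    have hsin2 : Real.sin θ = 2 * Real.sin (θ / 2) * Real.cos (θ / 2) := by
      rw [← Real.sin_two_mul, mul_div_cancel₀ _ two_ne_zero]
    have h1 : 1 ≤ C * (Real.cos (θ / 2) - 2 * Real.sin (θ / 2)) := by
      refine hC.trans (mul_le_mul_of_nonneg_left ?_ hC0)
      rw [hsin2]; linarith
    nlinarith
  · refine ⟨hcuv, fun x hx => ?_, a, ρ, hcirc, hempty, by rwa [dist_self]⟩
    obtain ⟨x₁, hx₁, x₂, hx₂, x₃, hx₃, h12, h23, h13, hangle⟩ := hskinny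
    have hlaw := dist_eq_two_mul_radius_mul_sin (hcirc x₁ hx₁) (hcirc x₂ hx₂) (hcirc x₃ hx₃)
      h12 h13 h23
    have hsin : Real.sin (EuclideanGeometry.angle x₁ x₂ x₃) ≤ Real.sin θ :=
      Real.sin_le_sin_of_le_of_le_pi_div_two
        (by linarith [Real.pi_pos, EuclideanGeometry.angle_nonneg x₁ x₂ x₃])
        (by linarith [Real.pi_pos]) hangle.le
    -- The edge opposite the skinny angle is at least as long as the shortest edge.
    have hE' : E ≤ 2 * ρ * Real.sin θ := by
      refine (hshort x₁ hx₁ x₃ hx₃ h13).trans (hlaw.le.trans ?_)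
      exact mul_le_mul_of_nonneg_left hsin (by positivity)
    have h1 := hempty x hx
    rw [dist_comm] at h1
    refine le_trans ?_ (mul_le_mul_of_nonneg_left h1 hC0)
    have h2 := mul_le_mul_of_nonneg_left hE' hC0
    have h3 := mul_le_mul_of_nonneg_right hC hρ0.le
    linarith

/-! ### The spacing invariant during the refinement -/

theorem Reachable.subset {θ : ℝ} {Ω : Set Plane} {S₀ S : Finset Plane}
    (h : Reachable θ Ω S₀ S) : S₀ ⊆ S := by
  induction h with
  | start => exact Finset.Subset.refl _
  | step _ _ ih => exact ih.trans (Finset.subset_insert _ _)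

/-- The points of `S` are far apart in terms of the local feature size. -/
def PSLG.IsSpaced (G : PSLG) (C : ℝ) (S : Finset Plane) : Prop :=
  ∀ u ∈ S, ∀ v ∈ S, u ≠ v → G.lfs u ≤ C * dist u v ∨ G.lfs v ≤ C * dist u v

namespace PSLG.IsSpaced

variable {G : PSLG} {C : ℝ} {S : Finset Plane}

theorem lfs_steiner_le {θ : ℝ} {Ω : Set Plane} {t : Finset Plane} {a : Plane}
    (hθ₀ : 0 < θ) (hθ : θ < Real.pi / 6) (hC0 : 0 ≤ C) (hC : 1 ≤ C * (1 - 2 * Real.sin θ))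
    (hS : G.IsSpaced C S) (h : Inserts θ Ω S t a) {x : Plane} (hx : x ∈ S) :
    G.lfs a ≤ C * dist a x := by
  obtain ⟨u, hu, v, hv, huv, hauv, hdist, -⟩ := h.exists_edge hθ₀ hθ hC0 hC
  refine le_trans ?_ (hdist x hx)
  rcases hS u hu v hv huv with h | h
  · linarith [G.lfs_le_lfs_add_dist a u]
  · linarith [G.lfs_le_lfs_add_dist a v]

-- The constant does not deteriorate, since the bound on the local feature size holds at the new
-- vertex itself against every old vertex.
open Classical in
theorem insert_steiner {θ : ℝ} {Ω : Set Plane} {t : Finset Plane} {a : Plane}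
    (hθ₀ : 0 < θ) (hθ : θ < Real.pi / 6) (hC0 : 0 ≤ C) (hC : 1 ≤ C * (1 - 2 * Real.sin θ))
    (hS : G.IsSpaced C S) (h : Inserts θ Ω S t a) : G.IsSpaced C (insert a S) := by
  have key {x : Plane} (hx : x ∈ S) := hS.lfs_steiner_le hθ₀ hθ hC0 hC h hx
  intro u hu v hv huv
  rcases Finset.mem_insert.1 hu with rfl | huS
  · rcases Finset.mem_insert.1 hv with rfl | hv
    · exact absurd rfl huv
    · exact Or.inl (key hv)
  · rcases Finset.mem_insert.1 hv with rfl | hv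
    · exact Or.inr (dist_comm u v ▸ key huS)
    · exact hS u huS v hv huv

theorem reachable {θ : ℝ} {Ω : Set Plane} {S₀ : Finset Plane}
    (hθ₀ : 0 < θ) (hθ : θ < Real.pi / 6) (hC0 : 0 ≤ C) (hC : 1 ≤ C * (1 - 2 * Real.sin θ))
    (hS₀ : G.IsSpaced C S₀) (h : Reachable θ Ω S₀ S) : G.IsSpaced C S := by
  induction h with
  | start => exact hS₀
  | step _ hins ih => exact ih.insert_steiner hθ₀ hθ hC0 hC hins

/-- The invariant does not say at which of the two points the bound holds; the Lipschitz property
transfers it to p at the price of 1 in the constant. -/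
theorem lfs_le (hS : G.IsSpaced C S) {z p : Plane} (hz : z ∈ S) (hp : p ∈ S)
    (hzp : z ≠ p) : G.lfs p ≤ (C + 1) * dist z p := by
  have := G.lfs_le_lfs_add_dist p z
  rw [dist_comm p z] at this
  rcases hS z hz p hp hzp with h | h
  · linarith
  · linarith [dist_nonneg (x := z) (y := p)]

/-- All other points lie outside the diametral circle of a subsegment. -/
theorem inner_pos {S₀ : Finset Plane} {A B : ℝ} (hS : G.IsSpaced C S) (hC0 : 0 ≤ C)
    (hCA : C + 1 < √2 * A) (hsub : S₀ ⊆ S) (hAB : G.SizeBounds S₀ A B) {p q z : Plane}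
    (hpq : G.IsSubsegment S₀ p q) (hqp : G.IsSubsegment S₀ q p) (hz : z ∈ S) (hzp : z ≠ p)
    (hzq : z ≠ q) : 0 < ⟪z - p, z - q⟫ := by
  have far {p q : Plane} (hpq : G.IsSubsegment S₀ p q) (hzp : z ≠ p) :
      dist p q / √2 < dist z p := by
    have hd : 0 < dist p q := dist_pos.2 hpq.2.2.1
    have h1 := (hAB p q hpq).1
    rw [le_div_iff₀ hd] at h1
    have h2 := hS.lfs_le hz (hsub hpq.1) hzp
    have h3 : (C + 1) * dist z p < √2 * A * dist z p :=
      mul_lt_mul_of_pos_right hCA (dist_pos.2 hzp)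
    have hA : 0 < A := by
      by_contra! hA
      have := mul_nonpos_of_nonneg_of_nonpos (Real.sqrt_nonneg 2) hA
      linarith
    rw [div_lt_iff₀ (by positivity)]
    have h4 : A * dist p q < A * (dist z p * √2) := by linarith
    exact lt_of_mul_lt_mul_left h4 hA.le
  exact inner_sub_sub_pos_of_dist (far hpq hzp) (dist_comm p q ▸ far hqp hzq)

end PSLG.IsSpaced

/-! ### Conclusion -/

theorem PSLG.IsSubsegment.symm {G : PSLG} {S : Finset Plane} {p q : Plane}
    (h : G.IsSubsegment S p q) : G.IsSubsegment S q p := by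
  obtain ⟨hp, hq, hpq, ⟨e, he, hpe, hqe⟩, hcons⟩ := h
  refine ⟨hq, hp, hpq.symm, ⟨e, he, hqe, hpe⟩, fun v hv hvs => ?_⟩
  rw [segment_symm] at hvs
  exact (hcons v hv hvs).symm

theorem mainTheorem6 (G : PSLG) (S₀ : Finset Plane) (Ω : Set Plane) (θ α A B : ℝ)
    (hθ₀ : 0 < θ) (hθ : θ < Real.pi / 6) (hα : α = 1 / (2 * Real.sin θ))
    (hA : 0 < A) (hS₀ : G.IsSplitting S₀) (hAB : G.SizeBounds S₀ A B)
    (hangle : G.NoSmallAngle A B)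
    (hcond : B / A + α / (A * (α - 1)) + 2 / A ≤ √2) :
    ∀ (S t : Finset Plane) (a : Plane), Reachable θ Ω S₀ S → Inserts θ Ω S t a →
      ∀ p q : Plane, G.IsSubsegment S₀ p q →
        a ∉ diametralDisk p q ∧ ¬ Encroaches t a p q := by
  classical
  intro S t a hreach hins p q hpq
  have hAleB : A ≤ B := (hAB p q hpq).1.trans (hAB p q hpq).2
  have hsin0 : 0 < Real.sin θ := Real.sin_pos_of_pos_of_lt_pi hθ₀ (by linarith [Real.pi_pos])
  have hsin1 : Real.sin θ < 1 / 2 := by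
    rw [← Real.sin_pi_div_six]
    exact Real.sin_lt_sin_of_lt_of_le_pi_div_two (by linarith [Real.pi_pos])
      (by linarith [Real.pi_pos]) hθ
  have hαsin : α / (α - 1) = 1 / (1 - 2 * Real.sin θ) := by
    have : 1 - 2 * Real.sin θ ≠ 0 := by linarith
    have h2 : α - 1 = (1 - 2 * Real.sin θ) / (2 * Real.sin θ) := by rw [hα]; field_simp
    rw [h2, hα]
    field_simp
  have hsin2 : 0 < 1 - 2 * Real.sin θ := by linarith
  have hα0 : 0 < α / (α - 1) := by rw [hαsin]; positivity
  have hcond' : B + α / (α - 1) + 2 ≤ √2 * A := by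
    have e : B / A + α / (A * (α - 1)) + 2 / A = (B + α / (α - 1) + 2) / A := by
      rw [mul_comm A, ← div_div]; ring
    rwa [e, div_le_iff₀ hA] at hcond
  -- The hypothesis gives B + 2 < √2 A ≤ 2B.
  have hB1 : 1 ≤ B := by
    have : √2 ≤ 2 := Real.sqrt_le_iff.2 ⟨by norm_num, by norm_num⟩
    nlinarith
  -- The summand B serves the initial points; the summand α / (α - 1) = 1 / (1 - 2 sin θ) serves the
  -- Steiner vertices.
  set C := B + α / (α - 1) with hCdef
  have hC0 : 0 ≤ C := by linarith
  have hC : 1 ≤ C * (1 - 2 * Real.sin θ) := by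
    have h1 : α / (α - 1) * (1 - 2 * Real.sin θ) = 1 := by
      rw [hαsin, div_mul_cancel₀ _ hsin2.ne']
    exact h1.ge.trans (mul_le_mul_of_nonneg_right (by linarith) hsin2.le)
  have hspaced₀ : G.IsSpaced C S₀ := by
    intro u hu v hv huv
    have hle : B * dist u v ≤ C * dist u v :=
      mul_le_mul_of_nonneg_right (by linarith) dist_nonneg
    exact (PSLG.lfs_le_of_mem_splitting hA hAleB hB1 hS₀ hAB hangle hu hv huv).imp
      (fun h => h.trans hle) fun h => h.trans hle
  have hspaced := hspaced₀.reachable hθ₀ hθ hC0 hC hreach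
  have hspaced' := hspaced.insert_steiner hθ₀ hθ hC0 hC hins
  obtain ⟨u, hu, v, hv, -, -, -, c, r, hcirc, hempty, hac⟩ := hins.exists_edge hθ₀ hθ hC0 hC
  -- The new vertex is strictly inside an empty circumcircle, so it differs from p and q.
  have haS : a ∉ S := fun h => absurd hac (not_lt.2 (hempty a h))
  have hpS := hreach.subset hpq.1
  have hqS := hreach.subset hpq.2.1
  have hout {z : Plane} (hz : z ∈ insert a S) (hzp : z ≠ p) (hzq : z ≠ q) :=
    hspaced'.inner_pos hC0 (by linarith) (hreach.subset.trans (Finset.subset_insert a S)) hAB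
      hpq hpq.symm hz hzp hzq
  have haout := hout (Finset.mem_insert_self a S) (fun h => haS (h ▸ hpS)) fun h => haS (h ▸ hqS)
  refine ⟨notMem_closedBall_of_inner_pos haout, ?_⟩
  rintro ⟨x, hx, hne⟩
  have htS : t ⊆ S := by
    obtain ⟨T, hT, htT, -⟩ := hins
    exact hT.subset t htT
  have := segment_inter_segment_eq_empty (hempty p hpS) (hempty q hqS) hcirc hac haout
    (fun z hz => hout (Finset.mem_insert_of_mem (htS hz))) hx
  exact hne.ne_empty this
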